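/- Let $q$ be a prime power and $n$ a non-negative integer. A matrix $A\in\mathbb{F}_{q^2}^{n\times n}$ is Hermitian if $A^*=A$, where $A^*$ is obtained by transposing $A$ and applying $x\mapsto x^q$ to every entry; let $\mathrm{H}_n(q^2)$ be the $\mathbb{F}_q$-vector space of these matrices, with the distance $d(A,B)=\mathrm{rk}(A-B)$. A Hermitian rank-metric code is an $\mathbb{F}_q$-linear subspace $\mathscr{C}\subseteq \mathrm{H}_n(q^2)$, and its minimum distance is $d(\mathscr{C})=\min\{d(A,B): A,B\in\mathscr{C},\ A\neq B\}$ (for $\mathscr{C}\neq\{0\}$). Let $B_r$ be the number of matrices in $\mathrm{H}_n(q^2)$ of rank at most $r$, that is, the size of any ball of radius $r$ in $\mathrm{H}_n(q^2)$. The packing density of $\mathscr{C}$ is $$\mathscr{D}(\mathscr{C})=\frac{|\mathscr{C}|\,B_t}{q^{n^2}},\qquad t=\left\lfloor\frac{d(\mathscr{C})-1}{2}\right\rfloor .$$ Let $\mathscr{C}\subseteq \mathrm{H}_n(q^2)$ be a Hermitian rank-metric code with minimum distance $d\in\{2,3,4,5,6\}$. Then $$\mathscr{D}(\mathscr{C})\leq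 \begin{cases} \dfrac{1}{q^n} & \text{if } d=2,\\[2mm] \dfrac{q^{-2n+1}+1}{q+1} & \text{if } d=3,\\[2mm] \dfrac{q^{-3n+1}+q^{-n}}{q+1} & \text{if } d=4,\\[2mm] q^{-4n}\left(1+\dfrac{q^{2n}-1}{q+1}+\dfrac{q(q^{2n}-1)(q^{2n-2}-1)}{(q+1)(q^2-1)}\right) & \text{if } d=5,\\[2mm] q^{-5n}\left(1+\dfrac{q^{2n}-1}{q+1}+\dfrac{q(q^{2n}-1)(q^{2n-2}-1)}{(q+1)(q^2-1)}\right) & \text{if } d=6. \end{cases}$$ -/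

import Mathlib

/-! Throughout, `K` is the finite field `𝔽_q` and `F` is its quadratic extension `𝔽_{q²}`. -/

namespace HermitianCode

section

variable (K F : Type*) [Field K] [Fintype K] [Field F] [Algebra K F] {n : ℕ}

/-- The conjugate transpose `A*`: transpose `A` and apply the conjugation `x ↦ x ^ q`, `q = |K|`,
to every entry. -/
def conjTranspose (A : Matrix (Fin n) (Fin n) F) : Matrix (Fin n) (Fin n) F :=
  Matrix.of fun i j => A j i ^ Fintype.card K

variable (n) in
/-- The `K`-vector space `H_n(q²)` of all Hermitian matrices of order `n` over `F`. -/
def hermitianMatrices : Submodule K (Matrix (Fin n) (Fin n) F) where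
  carrier := {A | conjTranspose K F A = A}
  zero_mem' := by
    ext i j
    simp [conjTranspose]
  add_mem' := by
    intro A B hA hB
    ext i j
    have h1 : A j i ^ Fintype.card K = A i j := congrFun (congrFun hA i) j
    have h2 : B j i ^ Fintype.card K = B i j := congrFun (congrFun hB i) j
    have h3 := map_add (FiniteField.frobeniusAlgHom K F) (A j i) (B j i)
    simp only [FiniteField.coe_frobeniusAlgHom] at h3
    simp [conjTranspose, h3, h1, h2]
  smul_mem' := by
    intro c A hA
    ext i j
    have h1 : A j i ^ Fintype.card K = A i j := congrFun (congrFun hA i) j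
    simp [conjTranspose, smul_pow, FiniteField.pow_card, h1]

variable {F}

/-- The rank distance between two matrices. -/
noncomputable def rankDist (A B : Matrix (Fin n) (Fin n) F) : ℕ := (A - B).rank

/-- The set of Hermitian matrices at rank distance at most `r` from `M`. -/
def ball (M : Matrix (Fin n) (Fin n) F) (r : ℕ) : Set (Matrix (Fin n) (Fin n) F) :=
  {N | N ∈ hermitianMatrices K F n ∧ rankDist M N ≤ r}

variable (F n) in
/-- The size `B_r` of a ball of radius `r` in `H_n(q²)`; it does not depend on the centre, see
`ncard_ball`. -/
noncomputable def ballSize (r : ℕ) : ℕ := (ball K (0 : Matrix (Fin n) (Fin n) F) r).ncard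

theorem ncard_ball {M : Matrix (Fin n) (Fin n) F} (hM : M ∈ hermitianMatrices K F n) (r : ℕ) :
    (ball K M r).ncard = ballSize K F n r := by
  have h : ball K M r = (fun N => M + N) '' ball K (0 : Matrix (Fin n) (Fin n) F) r := by
    ext N
    constructor
    · rintro ⟨hN, hr⟩
      refine ⟨N - M, ⟨Submodule.sub_mem _ hN hM, ?_⟩, by simp⟩
      simpa [rankDist] using hr
    · rintro ⟨N, ⟨hN, hr⟩, rfl⟩
      refine ⟨Submodule.add_mem _ hM hN, ?_⟩
      simpa [rankDist] using hr
  rw [h, Set.ncard_image_of_injective _ (add_right_injective M), ballSize]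

variable {K}

/-- The minimum distance `d(C)` of a code `C` (it is `0` by convention if `C` has only one
codeword). -/
noncomputable def minDist (C : Submodule K (Matrix (Fin n) (Fin n) F)) : ℕ :=
  sInf {r | ∃ A ∈ C, ∃ B ∈ C, A ≠ B ∧ rankDist A B = r}

/-- The packing density `|C| * B_t / q ^ (n ^ 2)` of a code `C` in `H_n(q²)`, where
`t = ⌊(d(C) - 1) / 2⌋`. -/
noncomputable def packingDensity (C : Submodule K (Matrix (Fin n) (Fin n) F)) : ℝ :=
  (Nat.card C : ℝ) * (ballSize K F n ((minDist C - 1) / 2) : ℝ) /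
    (Fintype.card K : ℝ) ^ (n ^ 2)

end

end HermitianCode

/-!
# Packing density of linear Hermitian rank-metric codes

Let `q = |K|` and `j = d - 1`. The bounds follow from two facts: the exact sizes of the balls of
radius at most `2`, and the Singleton-like bound `|C| * q ^ (n * j) ≤ q ^ (n ^ 2)` for a linear code
of minimum distance `d`, of any parity (`card_mul_pow_le`).

The Singleton-like bound is a divisibility statement about the dual code `C'` with respect to the
trace form. Fix a nontrivial additive character of `K`. The exponential sum of the Hermitian form
`x ↦ x* B x` is `(-1) ^ r * q ^ (2 * n - r)`, where `r` is the rank of `B` (`expSum_mul`); that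
is, it is `b ^ n` times `y_B = b ^ (n - r)`, where `b = -q`. The `k`-th power of an exponential
sum is a sum over the families `x_1, …, x_k` of vectors, so that the `k`-th moment over `C'`
counts the families for which `∑ x_i x_i*` is in `C` (`sum_orthogonal_expSum_pow`). This matrix
has rank at most `k`, so for `k ≤ j` it is in `C` only if it vanishes. Hence the moments of `y_B`
of order at most `j` are the same for `C'` as for the space of all Hermitian matrices. For the
polynomial `P(y) = (y - 1) (y - b) ⋯ (y - b ^ (j - 1))` the average over all Hermitian matrices is
`(-1) ^ j * b ^ (-n * j) * P(b ^ n)` (`sum_qProd`), and therefore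

  `b ^ (n * j) * ∑ B ∈ C', P(y_B) = (-1) ^ j * |C'| * P(b ^ n)`   (`sum_orthogonal_qProd`).

All the integers `P(b ^ m)` are divisible by `D = ∏ b ^ i`, `i < j`, and `P(b ^ n) / D` is prime
to `q`. So `q ^ (n * j)` divides `|C'| = q ^ (n ^ 2) / |C|`, which is the bound.

The exponential sums, the average of `P` and the rank distribution are all computed by induction on
`n`, by bordering a Hermitian matrix `B` of order `n` and rank `r` with a column `v` and a diagonal
entry `c`. If `v` is outside the range of `B`, the rank increases by `2` and the exponential sum is
unchanged; if `v = B u`, the bordered matrix is congruent to the direct sum of `B` and the `1 × 1`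
matrix `c - u* B u`. Counting the pairs `(v, c)` gives the recursion `sum_rank_succ`.
-/

namespace HermitianCode

open Finset Matrix
open scoped Classical

/-! ### Trace, norm and additive characters of a quadratic extension of finite fields -/

section Field

variable {K F : Type*} [Field K] [Fintype K] [Field F] [Algebra K F]

local notation "σ" => FiniteField.frobeniusAlgHom K F
local notation "q" => Fintype.card K

theorem algebraMap_trace_eq_add_frobenius [Finite F] (hKF : Module.finrank K F = 2) (x : F) :
    algebraMap K F (Algebra.trace K F x) = x + σ x := by
  rw [FiniteField.algebraMap_trace_eq_sum_pow, hKF]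
  simp [Finset.sum_range_succ, Nat.card_eq_fintype_card]

theorem algebraMap_norm_eq_mul_frobenius [Finite F] (hKF : Module.finrank K F = 2) (x : F) :
    algebraMap K F (Algebra.norm K x) = x * σ x := by
  rw [FiniteField.algebraMap_norm_eq_prod_pow, hKF]
  simp [Finset.prod_range_succ, Nat.card_eq_fintype_card]

theorem card_eq_sq [Fintype F] (hKF : Module.finrank K F = 2) : Fintype.card F = q ^ 2 := by
  rw [Module.card_eq_pow_finrank (K := K), hKF]

theorem frobenius_frobenius [Fintype F] (hKF : Module.finrank K F = 2) (x : F) : σ (σ x) = x := by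
  simp only [FiniteField.coe_frobeniusAlgHom]
  rw [← pow_mul, ← sq, ← card_eq_sq (F := F) hKF, FiniteField.pow_card]

theorem exists_algebraMap_eq_of_frobenius_eq [Fintype F] {x : F} (hx : σ x = x) :
    ∃ c : K, algebraMap K F c = x := by
  by_contra! h
  have hne : (Polynomial.X ^ q - Polynomial.X : Polynomial F) ≠ 0 :=
    FiniteField.X_pow_card_sub_X_ne_zero F Fintype.one_lt_card
  have hsub : insert x (univ.image (algebraMap K F)) ⊆
      (Polynomial.X ^ q - Polynomial.X : Polynomial F).roots.toFinset := by
    intro y hy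
    rw [Multiset.mem_toFinset, Polynomial.mem_roots hne]
    rcases Finset.mem_insert.1 hy with rfl | hy
    · simpa [sub_eq_zero] using hx
    · obtain ⟨c, -, rfl⟩ := Finset.mem_image.1 hy
      simp [← map_pow, FiniteField.pow_card]
  have h1 := Finset.card_le_card hsub
  have h2 := (Multiset.toFinset_card_le _).trans
    (Polynomial.card_roots' (Polynomial.X ^ q - Polynomial.X : Polynomial F))
  rw [FiniteField.X_pow_card_sub_X_natDegree_eq F Fintype.one_lt_card] at h2
  rw [Finset.card_insert_of_notMem (by simpa using h),
    Finset.card_image_of_injective _ (algebraMap K F).injective, Finset.card_univ] at h1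
  omega

variable {ψ : AddChar K ℂ}

theorem sum_addChar_mul (hψ : ψ ≠ 1) (a : K) :
    ∑ c : K, ψ (c * a) = if a = 0 then (q : ℂ) else 0 :=
  mod_cast AddChar.sum_mulShift a (AddChar.IsPrimitive.of_ne_one hψ)

theorem sum_addChar_trace [Fintype F] (hψ : ψ ≠ 1) {s : F} (hs : s ≠ 0) :
    ∑ x : F, ψ (Algebra.trace K F (s * x)) = 0 := by
  have h1 : ψ.compAddMonoidHom (Algebra.trace K F).toAddMonoidHom ≠ 1 := by
    obtain ⟨a, ha⟩ := AddChar.ne_one_iff.1 hψ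
    obtain ⟨z, rfl⟩ := Algebra.trace_surjective K F a
    exact AddChar.ne_one_iff.2 ⟨z, by simpa using ha⟩
  rw [← AddChar.sum_eq_zero_of_ne_one h1]
  exact Fintype.sum_equiv (Equiv.mulLeft₀ s hs) _ _ fun x => by simp

/-- For `c ≠ 0` the sum does not depend on `c`, since the norm is onto; its value follows by
summing over all `c`. -/
theorem sum_addChar_norm [Fintype F] (hKF : Module.finrank K F = 2) (hψ : ψ ≠ 1) (c : K) :
    ∑ x : F, ψ (c * Algebra.norm K x) = if c = 0 then (q : ℂ) ^ 2 else -(q : ℂ) := by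
  have h0 : ∑ x : F, ψ (0 * Algebra.norm K x) = (q : ℂ) ^ 2 := by
    simp [card_eq_sq (F := F) hKF]
  have hc : ∀ c : K, c ≠ 0 →
      ∑ x : F, ψ (c * Algebra.norm K x) = ∑ x : F, ψ (1 * Algebra.norm K x) := by
    intro c hc
    obtain ⟨s, hs⟩ := FiniteField.norm_surjective K F c
    have hs0 : s ≠ 0 := by rintro rfl; exact hc (by simpa using hs.symm)
    exact Fintype.sum_equiv (Equiv.mulLeft₀ s hs0) _ _ fun x => by simp [hs]
  have htot : ∑ c : K, ∑ x : F, ψ (c * Algebra.norm K x) = (q : ℂ) := by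
    rw [Finset.sum_comm]
    simp [sum_addChar_mul hψ, Algebra.norm_eq_zero_iff]
  have hq : ((q - 1 : ℕ) : ℂ) ≠ 0 := by
    have := Fintype.one_lt_card (α := K)
    exact_mod_cast (by omega : q - 1 ≠ 0)
  rw [← Finset.add_sum_erase _ _ (Finset.mem_univ (0 : K)), h0,
    Finset.sum_congr rfl fun c hc' => hc c (Finset.ne_of_mem_erase hc'), Finset.sum_const,
    Finset.card_erase_of_mem (Finset.mem_univ _), Finset.card_univ, nsmul_eq_mul] at htot
  split_ifs with h
  · rw [h, h0]
  · rw [hc c h]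
    apply mul_left_cancel₀ hq
    rw [eq_sub_of_add_eq' htot, Nat.cast_sub Fintype.card_pos]
    push_cast
    ring

end Field

/-! ### Sesquilinear forms and bordered Hermitian matrices -/

section Bordered

theorem sum_fin_succ_fun {F : Type*} [Fintype F] {n : ℕ} {R : Type*} [AddCommMonoid R]
    (f : (Fin (n + 1) → F) → R) :
    ∑ y, f y = ∑ t : F, ∑ x : Fin n → F, f (Fin.cons t x) := by
  rw [← Fintype.sum_prod_type' (f := fun t x => f (Fin.cons t x))]
  exact (Fintype.sum_equiv (Fin.consEquiv fun _ => F) _ _ fun _ => rfl).symm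

variable {K F : Type*} [Field K] [Fintype K] [Field F] [Algebra K F] {n : ℕ}

local notation "σ" => FiniteField.frobeniusAlgHom K F
local notation "q" => Fintype.card K

variable (K) in
/-- The sesquilinear form `x* B y` of a matrix `B`. -/
def sesq (B : Matrix (Fin n) (Fin n) F) (x y : Fin n → F) : F :=
  (fun i => σ (x i)) ⬝ᵥ B *ᵥ y

variable (K) in
/-- The matrix `B` bordered by a first column `(c, v)` and a first row `(c, v*)`. -/
def bordered (c : K) (v : Fin n → F) (B : Matrix (Fin n) (Fin n) F) :
    Matrix (Fin (n + 1)) (Fin (n + 1)) F :=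
  Matrix.of (Fin.cons (Fin.cons (algebraMap K F c) fun i => σ (v i))
    fun i => Fin.cons (v i) (B i))

theorem apply_eq_of_mem {B : Matrix (Fin n) (Fin n) F} (hB : B ∈ hermitianMatrices K F n)
    (i j : Fin n) : σ (B j i) = B i j :=
  congrFun (congrFun hB i) j

theorem mem_hermitianMatrices {B : Matrix (Fin n) (Fin n) F} :
    B ∈ hermitianMatrices K F n ↔ ∀ i j, σ (B j i) = B i j :=
  ⟨apply_eq_of_mem, fun h => by ext i j; exact h i j⟩

theorem sesq_add_left (B : Matrix (Fin n) (Fin n) F) (x x' y : Fin n → F) :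
    sesq K B (x + x') y = sesq K B x y + sesq K B x' y := by
  simp only [sesq, dotProduct, Pi.add_apply, map_add, add_mul, Finset.sum_add_distrib]

theorem sesq_add_right (B : Matrix (Fin n) (Fin n) F) (x y y' : Fin n → F) :
    sesq K B x (y + y') = sesq K B x y + sesq K B x y' := by
  simp only [sesq, mulVec_add, dotProduct_add]

theorem sesq_smul_left (B : Matrix (Fin n) (Fin n) F) (t : F) (x y : Fin n → F) :
    sesq K B (t • x) y = σ t * sesq K B x y := by
  simp only [sesq, dotProduct, Pi.smul_apply, smul_eq_mul, map_mul, Finset.mul_sum, mul_assoc]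

theorem sesq_smul_right (B : Matrix (Fin n) (Fin n) F) (t : F) (x y : Fin n → F) :
    sesq K B x (t • y) = t * sesq K B x y := by
  simp only [sesq, mulVec_smul, dotProduct_smul, smul_eq_mul]

theorem frobenius_mulVec (B : Matrix (Fin n) (Fin n) F) (x : Fin n → F) (i : Fin n) :
    σ ((B *ᵥ x) i) = ∑ j, σ (B i j) * σ (x j) := by
  simp only [mulVec, dotProduct, map_sum, map_mul]

theorem frobenius_mulVec_dotProduct {B : Matrix (Fin n) (Fin n) F}
    (hB : B ∈ hermitianMatrices K F n) (x y : Fin n → F) :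
    (fun i => σ ((B *ᵥ x) i)) ⬝ᵥ y = sesq K B x y := by
  simp only [frobenius_mulVec]
  simp only [sesq, dotProduct, mulVec, Finset.sum_mul, Finset.mul_sum]
  rw [Finset.sum_comm]
  refine Finset.sum_congr rfl fun j _ => Finset.sum_congr rfl fun i _ => ?_
  rw [apply_eq_of_mem hB]
  ring

theorem frobenius_sesq [Fintype F] (hKF : Module.finrank K F = 2) {B : Matrix (Fin n) (Fin n) F}
    (hB : B ∈ hermitianMatrices K F n) (x y : Fin n → F) :
    σ (sesq K B x y) = sesq K B y x := by
  rw [← frobenius_mulVec_dotProduct hB y x, dotProduct_comm]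
  simp only [sesq, dotProduct, map_sum, map_mul, frobenius_frobenius hKF]

theorem bordered_mem [Fintype F] (hKF : Module.finrank K F = 2) (c : K) (v : Fin n → F)
    {B : Matrix (Fin n) (Fin n) F} (hB : B ∈ hermitianMatrices K F n) :
    bordered K c v B ∈ hermitianMatrices K F (n + 1) := by
  rw [mem_hermitianMatrices]
  intro i j
  refine Fin.cases ?_ (fun i => ?_) i <;> refine Fin.cases ?_ (fun j => ?_) j
  · simp only [bordered, of_apply, Fin.cons_zero]
    exact AlgHom.commutes _ _
  · simp only [bordered, of_apply, Fin.cons_zero, Fin.cons_succ]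
  · simp only [bordered, of_apply, Fin.cons_zero, Fin.cons_succ]
    exact frobenius_frobenius hKF _
  · simp only [bordered, of_apply, Fin.cons_succ]
    exact apply_eq_of_mem hB _ _

theorem bordered_mulVec (c : K) (v : Fin n → F) (B : Matrix (Fin n) (Fin n) F) (t : F)
    (x : Fin n → F) :
    bordered K c v B *ᵥ (Fin.cons t x) =
      Fin.cons (algebraMap K F c * t + (fun i => σ (v i)) ⬝ᵥ x) (B *ᵥ x + t • v) := by
  ext i
  refine Fin.cases ?_ (fun i => ?_) i
  · simp [bordered, mulVec, dotProduct, Fin.sum_univ_succ]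
  · simp only [bordered, mulVec, dotProduct, Fin.sum_univ_succ, of_apply, Fin.cons_succ,
      Fin.cons_zero, Pi.add_apply, Pi.smul_apply, smul_eq_mul]
    ring

theorem sesq_bordered (c : K) (v : Fin n → F) (B : Matrix (Fin n) (Fin n) F) (t : F)
    (x : Fin n → F) :
    sesq K (bordered K c v B) (Fin.cons t x) (Fin.cons t x) =
      σ t * (algebraMap K F c * t + (fun i => σ (v i)) ⬝ᵥ x) + sesq K B x x +
        t * (fun i => σ (x i)) ⬝ᵥ v := by
  rw [sesq, bordered_mulVec]
  simp only [dotProduct, Fin.sum_univ_succ, Fin.cons_zero, Fin.cons_succ, sesq, Pi.add_apply,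
    Pi.smul_apply, smul_eq_mul, mul_add, Finset.sum_add_distrib, Finset.mul_sum, add_assoc]
  congr 3
  exact Finset.sum_congr rfl fun i _ => by ring_nf

theorem exists_eq_bordered [Fintype F] {M : Matrix (Fin (n + 1)) (Fin (n + 1)) F}
    (hM : M ∈ hermitianMatrices K F (n + 1)) :
    ∃ (c : K) (v : Fin n → F) (B : Matrix (Fin n) (Fin n) F),
      B ∈ hermitianMatrices K F n ∧ bordered K c v B = M := by
  obtain ⟨c, hc⟩ := exists_algebraMap_eq_of_frobenius_eq (apply_eq_of_mem hM 0 0)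
  refine ⟨c, fun i => M i.succ 0, M.submatrix Fin.succ Fin.succ,
    mem_hermitianMatrices.2 fun i j => apply_eq_of_mem hM _ _, ?_⟩
  ext i j
  refine Fin.cases ?_ (fun i => ?_) i <;> refine Fin.cases ?_ (fun j => ?_) j
  · simpa [bordered] using hc
  · simpa only [bordered, of_apply, Fin.cons_zero, Fin.cons_succ] using apply_eq_of_mem hM _ _
  · simp only [bordered, of_apply, Fin.cons_zero, Fin.cons_succ]
  · simp only [bordered, of_apply, Fin.cons_succ, submatrix_apply]

/-- Every Hermitian matrix of order `n + 1` is obtained from its lower right corner by bordering,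
in exactly one way. -/
theorem sum_hermitianMatrices_succ [Fintype F] (hKF : Module.finrank K F = 2) {R : Type*}
    [AddCommMonoid R] (f : Matrix (Fin (n + 1)) (Fin (n + 1)) F → R) :
    ∑ M : hermitianMatrices K F (n + 1), f M =
      ∑ B : hermitianMatrices K F n, ∑ v : Fin n → F, ∑ c : K, f (bordered K c v B) := by
  simp_rw [← Fintype.sum_prod_type' (f := fun v c => f (bordered K c v _))]
  rw [← Fintype.sum_prod_type' (f := fun (B : hermitianMatrices K F n) (p : (Fin n → F) × K) =>
    f (bordered K p.2 p.1 B.1))]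
  symm
  refine Fintype.sum_bijective
    (fun p : hermitianMatrices K F n × (Fin n → F) × K =>
      (⟨bordered K p.2.2 p.2.1 p.1.1, bordered_mem hKF _ _ p.1.2⟩ :
        hermitianMatrices K F (n + 1))) ⟨?_, ?_⟩ _ _ fun _ => rfl
  · rintro ⟨⟨B, hB⟩, v, c⟩ ⟨⟨B', hB'⟩, v', c'⟩ h
    have h' : bordered K c v B = bordered K c' v' B' := congrArg Subtype.val h
    have hc : c = c' := (algebraMap K F).injective <| by
      simpa [bordered] using congrFun (congrFun h' 0) 0
    have hv : v = v' := by
      ext i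
      simpa [bordered] using congrFun (congrFun h' i.succ) 0
    have hB : B = B' := by
      ext i j
      simpa [bordered] using congrFun (congrFun h' i.succ) j.succ
    subst hc hv hB
    rfl
  · rintro ⟨M, hM⟩
    obtain ⟨c, v, B, hB, rfl⟩ := exists_eq_bordered hM
    exact ⟨⟨⟨B, hB⟩, v, c⟩, rfl⟩

/-- The number of vectors in the kernel of `B`. -/
noncomputable def kerCard {m : ℕ} [Fintype F] (B : Matrix (Fin m) (Fin m) F) : ℕ :=
  ∑ x : Fin m → F, if B *ᵥ x = 0 then 1 else 0

theorem card_range_mulVec [Fintype F] (hKF : Module.finrank K F = 2)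
    (B : Matrix (Fin n) (Fin n) F) :
    #{v : Fin n → F | ∃ u, B *ᵥ u = v} = (q ^ 2) ^ B.rank := by
  rw [← card_eq_sq (F := F) hKF, Matrix.rank, ← Module.card_eq_pow_finrank, Fintype.card_subtype]
  congr 1
  ext v
  simp [LinearMap.mem_range]

theorem kerCard_mul [Fintype F] (hKF : Module.finrank K F = 2) (B : Matrix (Fin n) (Fin n) F) :
    kerCard B * (q ^ 2) ^ B.rank = (q ^ 2) ^ n := by
  have h : kerCard B = (q ^ 2) ^ Module.finrank F (LinearMap.ker B.mulVecLin) := by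
    rw [← card_eq_sq (F := F) hKF, ← Module.card_eq_pow_finrank, Fintype.card_subtype, kerCard,
      Finset.sum_boole]
    simp [LinearMap.mem_ker]
  rw [h, ← pow_add, Matrix.rank, add_comm, LinearMap.finrank_range_add_finrank_ker]
  simp

/-- Ranks are compared through the sizes of the kernels. -/
theorem rank_eq_add_of_kerCard [Fintype F] (hKF : Module.finrank K F = 2) {m k : ℕ}
    {B : Matrix (Fin n) (Fin n) F} {M : Matrix (Fin m) (Fin m) F}
    (h : kerCard M * (q ^ 2) ^ k * (q ^ 2) ^ n = kerCard B * (q ^ 2) ^ m) :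
    M.rank = B.rank + k := by
  have hq : 1 < q ^ 2 := Nat.one_lt_pow two_ne_zero Fintype.one_lt_card
  apply Nat.pow_right_injective hq
  have h1 := kerCard_mul hKF B
  have h2 := kerCard_mul hKF M
  have hM : 0 < kerCard M :=
    Nat.pos_of_mul_pos_right (b := (q ^ 2) ^ M.rank) (by rw [h2]; positivity)
  have hpos : 0 < kerCard M * (q ^ 2) ^ n := by positivity
  apply Nat.eq_of_mul_eq_mul_left hpos
  simp only
  calc kerCard M * (q ^ 2) ^ n * (q ^ 2) ^ M.rank
      = (kerCard M * (q ^ 2) ^ M.rank) * (q ^ 2) ^ n := by ring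
    _ = (kerCard B * (q ^ 2) ^ m) * (q ^ 2) ^ B.rank := by rw [h2, ← h1]; ring
    _ = _ := by rw [← h]; ring

end Bordered

/-! ### The rank and the exponential sum of a bordered matrix -/

section RankStep

variable {K F : Type*} [Field K] [Fintype K] [Field F] [Algebra K F] {n : ℕ}

local notation "σ" => FiniteField.frobeniusAlgHom K F
local notation "q" => Fintype.card K

/-- The exponential sum of the form `x ↦ x* B x` with respect to an additive character `ψ` of `K`.
The form takes values in (the image of) `K`; they are read off by a linear map `lam : F → K` that
is the identity on `K`. -/
noncomputable def expSum {m : ℕ} [Fintype F] (ψ : AddChar K ℂ) (lam : F →ₗ[K] K)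
    (B : Matrix (Fin m) (Fin m) F) : ℂ :=
  ∑ x : Fin m → F, ψ (lam (sesq K B x x))

section RangeCase

variable {B : Matrix (Fin n) (Fin n) F} {c a : K} {u : Fin n → F}

theorem sesq_bordered_mulVec [Fintype F] (hKF : Module.finrank K F = 2)
    (hB : B ∈ hermitianMatrices K F n) (ha : algebraMap K F a = sesq K B u u)
    (t : F) (x : Fin n → F) :
    sesq K (bordered K c (B *ᵥ u) B) (Fin.cons t x) (Fin.cons t x) =
      sesq K B (x + t • u) (x + t • u) + algebraMap K F ((c - a) * Algebra.norm K t) := by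
  rw [sesq_bordered, frobenius_mulVec_dotProduct hB]
  change _ + t * sesq K B x u = _
  simp only [sesq_add_left, sesq_add_right, sesq_smul_left, sesq_smul_right, map_mul, map_sub, ha,
    algebraMap_norm_eq_mul_frobenius hKF]
  ring

theorem expSum_bordered_mulVec [Fintype F] (hKF : Module.finrank K F = 2) {ψ : AddChar K ℂ}
    (hψ : ψ ≠ 1) {lam : F →ₗ[K] K} (hlam : ∀ c, lam (algebraMap K F c) = c)
    (hB : B ∈ hermitianMatrices K F n) (ha : algebraMap K F a = sesq K B u u) :
    expSum ψ lam (bordered K c (B *ᵥ u) B) =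
      expSum ψ lam B * if c = a then (q : ℂ) ^ 2 else -(q : ℂ) := by
  have h := sum_addChar_norm (F := F) hKF hψ (c - a)
  simp only [sub_eq_zero] at h
  rw [← h, expSum, sum_fin_succ_fun, Finset.mul_sum]
  refine Finset.sum_congr rfl fun t _ => ?_
  rw [expSum, Finset.sum_mul]
  refine Fintype.sum_equiv (Equiv.addRight (t • u)) _ _ fun x => ?_
  rw [sesq_bordered_mulVec hKF hB ha, map_add, hlam, AddChar.map_add_eq_mul]
  rfl

theorem kerCard_bordered_mulVec [Fintype F] (hKF : Module.finrank K F = 2)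
    (hB : B ∈ hermitianMatrices K F n) (ha : algebraMap K F a = sesq K B u u) :
    kerCard (bordered K c (B *ᵥ u) B) = kerCard B * if c = a then q ^ 2 else 1 := by
  have key : ∀ (t : F) (x : Fin n → F), bordered K c (B *ᵥ u) B *ᵥ Fin.cons t x = 0 ↔
      (c = a ∨ t = 0) ∧ B *ᵥ (x + t • u) = 0 := by
    intro t x
    rw [bordered_mulVec, frobenius_mulVec_dotProduct hB, ← mulVec_smul, ← mulVec_add]
    refine (cons_eq_zero_iff).trans (and_congr_left fun h0 => ?_)
    have h1 : sesq K B u x = - (t * algebraMap K F a) := by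
      have : sesq K B u (x + t • u) = 0 := by rw [sesq, h0, dotProduct_zero]
      rw [sesq_add_right, sesq_smul_right, ← ha] at this
      exact eq_neg_of_add_eq_zero_left this
    rw [h1, ← sub_eq_add_neg, mul_comm t, ← sub_mul, ← map_sub, mul_eq_zero, map_eq_zero,
      sub_eq_zero]
  -- translating `x` by `-t • u` separates the two conditions
  have hsum : ∀ t : F, (∑ x : Fin n → F, if B *ᵥ (x + t • u) = 0 then 1 else 0) = kerCard B :=
    fun t => Fintype.sum_equiv (Equiv.addRight (t • u)) _ _ fun x => rfl
  rw [kerCard, sum_fin_succ_fun]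
  simp only [key, ite_and]
  by_cases h : c = a
  · simp [h, hsum, card_eq_sq (F := F) hKF, mul_comm]
  · have : ∀ t : F, (∑ x : Fin n → F, if t = 0 then (if B *ᵥ (x + t • u) = 0 then 1 else 0) else 0)
        = if t = 0 then kerCard B else 0 := by
      intro t
      split_ifs
      · exact hsum t
      · simp
    simp [h, this]

theorem rank_bordered_mulVec [Fintype F] (hKF : Module.finrank K F = 2)
    (hB : B ∈ hermitianMatrices K F n) (ha : algebraMap K F a = sesq K B u u) :
    (bordered K c (B *ᵥ u) B).rank = B.rank + if c = a then 0 else 1 := by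
  apply rank_eq_add_of_kerCard hKF
  rw [kerCard_bordered_mulVec hKF hB ha]
  split_ifs <;> ring

end RangeCase

section NotRangeCase

variable {B : Matrix (Fin n) (Fin n) F} {c : K} {v : Fin n → F}

/-- The range of a Hermitian matrix is the orthogonal complement of its kernel. -/
theorem exists_mulVec_eq_zero_of_notMem_range
    (hB : B ∈ hermitianMatrices K F n) (hv : ¬ ∃ u, B *ᵥ u = v) :
    ∃ w, B *ᵥ w = 0 ∧ (fun i => σ (v i)) ⬝ᵥ w = 1 := by
  obtain ⟨φ, hφv, hφ⟩ := Submodule.exists_dual_map_eq_bot_of_notMem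
    (p := LinearMap.range B.mulVecLin) (x := v) (by simpa using hv) inferInstance
  have hφ' : ∀ u, φ (B *ᵥ u) = 0 := fun u => by
    rw [← Submodule.mem_bot F, ← hφ]
    exact Submodule.mem_map_of_mem ⟨u, rfl⟩
  let a : Fin n → F := fun i => φ fun j => if i = j then 1 else 0
  have ha : ∀ y, φ y = ∑ i, y i * a i := fun y => by
    simpa using φ.pi_apply_eq_sum_univ y
  have hs : σ (φ v) ≠ 0 := by simpa using hφv
  -- the conjugated coefficients of a functional that vanishes on the range form a kernel vector
  refine ⟨(σ (φ v))⁻¹ • fun i => σ (a i), ?_, ?_⟩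
  · rw [mulVec_smul]
    convert smul_zero (σ (φ v))⁻¹ using 2
    ext k
    have h := congrArg σ (hφ' (Pi.single k 1))
    rw [ha, map_sum, mulVec_single_one] at h
    simpa [-FiniteField.frobeniusAlgHom_apply, mulVec, dotProduct, map_mul,
      ← apply_eq_of_mem hB k] using h
  · rw [dotProduct_smul, smul_eq_mul]
    convert inv_mul_cancel₀ hs using 2
    simp only [ha, map_sum, map_mul, dotProduct]

theorem kerCard_bordered_of_notMem_range [Fintype F] (hKF : Module.finrank K F = 2)
    (hB : B ∈ hermitianMatrices K F n) (hv : ¬ ∃ u, B *ᵥ u = v) :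
    kerCard (bordered K c v B) * q ^ 2 = kerCard B := by
  obtain ⟨w, hw, hvw⟩ := exists_mulVec_eq_zero_of_notMem_range hB hv
  have key : ∀ (t : F) (x : Fin n → F), bordered K c v B *ᵥ Fin.cons t x = 0 ↔
      t = 0 ∧ (B *ᵥ x = 0 ∧ (fun i => σ (v i)) ⬝ᵥ x = 0) := by
    intro t x
    rw [bordered_mulVec]
    refine (cons_eq_zero_iff).trans ?_
    constructor
    · rintro ⟨h1, h2⟩
      have ht : t = 0 := by
        by_contra ht
        refine hv ⟨- t⁻¹ • x, ?_⟩
        rw [mulVec_smul, eq_neg_of_add_eq_zero_left h2, smul_neg, neg_smul, neg_neg, smul_smul,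
          inv_mul_cancel₀ ht, one_smul]
      subst ht
      exact ⟨rfl, by simpa using h2, by simpa using h1⟩
    · rintro ⟨rfl, h1, h2⟩
      simp [-FiniteField.frobeniusAlgHom_apply, h1, h2]
  have hker : kerCard (bordered K c v B) =
      ∑ x : Fin n → F, if B *ᵥ x = 0 ∧ (fun i => σ (v i)) ⬝ᵥ x = 0 then 1 else 0 := by
    rw [kerCard, sum_fin_succ_fun, Fintype.sum_eq_single 0]
    · simp only [key, true_and]
    · intro t ht
      simp [key, ht]
  -- translation along `w` moves the hyperplane `v* x = 0` through all its parallels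
  calc kerCard (bordered K c v B) * q ^ 2
      = ∑ s : F, ∑ x : Fin n → F,
          if B *ᵥ x = 0 ∧ (fun i => σ (v i)) ⬝ᵥ x = 0 then 1 else 0 := by
        simp only [hker, Finset.sum_const, Finset.card_univ, card_eq_sq (F := F) hKF, smul_eq_mul]
        ring
    _ = ∑ s : F, ∑ x : Fin n → F,
          if B *ᵥ x = 0 ∧ (fun i => σ (v i)) ⬝ᵥ x = -s then 1 else 0 := by
        refine Finset.sum_congr rfl fun s _ => ?_
        refine (Fintype.sum_equiv (Equiv.addRight (s • w)) _ _ fun x => ?_).symm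
        simp [-FiniteField.frobeniusAlgHom_apply, mulVec_add, mulVec_smul, hw, hvw,
          dotProduct_add, dotProduct_smul, eq_neg_iff_add_eq_zero]
    _ = kerCard B := by
        rw [Finset.sum_comm, kerCard]
        refine Finset.sum_congr rfl fun x _ => ?_
        simp [ite_and, ← neg_eq_iff_eq_neg]

theorem rank_bordered_of_notMem_range [Fintype F] (hKF : Module.finrank K F = 2)
    (hB : B ∈ hermitianMatrices K F n) (hv : ¬ ∃ u, B *ᵥ u = v) :
    (bordered K c v B).rank = B.rank + 2 := by
  apply rank_eq_add_of_kerCard hKF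
  rw [← kerCard_bordered_of_notMem_range (c := c) hKF hB hv]
  ring

/-- Averaging over translations along a vector `w` of the kernel with `v* w = 1` annihilates all
terms outside the hyperplane where the first coordinate vanishes. -/
theorem expSum_bordered_of_notMem_range [Fintype F] (hKF : Module.finrank K F = 2)
    {ψ : AddChar K ℂ} (hψ : ψ ≠ 1) {lam : F →ₗ[K] K} (hlam : ∀ c, lam (algebraMap K F c) = c)
    (hB : B ∈ hermitianMatrices K F n) (hv : ¬ ∃ u, B *ᵥ u = v) :
    expSum ψ lam (bordered K c v B) = expSum ψ lam B := by
  obtain ⟨w, hw, hvw⟩ := exists_mulVec_eq_zero_of_notMem_range hB hv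
  have hwv : (fun i => σ (w i)) ⬝ᵥ v = 1 := by
    have h := congrArg σ hvw
    rw [dotProduct_comm]
    simpa only [dotProduct, map_sum, map_mul, frobenius_frobenius hKF, map_one] using h
  have hshift : ∀ (t s : F) (x : Fin n → F),
      sesq K (bordered K c v B) (Fin.cons t (x + s • w)) (Fin.cons t (x + s • w)) =
        sesq K (bordered K c v B) (Fin.cons t x) (Fin.cons t x) +
          algebraMap K F (Algebra.trace K F (σ t * s)) := by
    intro t s x
    have h1 : ∀ y, sesq K B y w = 0 := fun y => by rw [sesq, hw, dotProduct_zero]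
    have h2 : ∀ y, sesq K B w y = 0 := fun y => by rw [← frobenius_sesq hKF hB, h1, map_zero]
    have h3 : (fun i => σ ((x + s • w) i)) ⬝ᵥ v = (fun i => σ (x i)) ⬝ᵥ v + σ s := by
      rw [← mul_one (σ s), ← hwv]
      simp only [dotProduct, Pi.add_apply, Pi.smul_apply, smul_eq_mul, map_add, map_mul, add_mul,
        Finset.sum_add_distrib, Finset.mul_sum, mul_assoc]
    rw [sesq_bordered, sesq_bordered, h3, algebraMap_trace_eq_add_frobenius hKF, map_mul,
      frobenius_frobenius hKF, dotProduct_add, dotProduct_smul, hvw]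
    simp only [sesq_add_left, sesq_add_right, sesq_smul_left, sesq_smul_right, h1, h2, smul_eq_mul]
    ring
  have hq : (q : ℂ) ^ 2 ≠ 0 := by simp
  apply mul_left_cancel₀ hq
  have hcard : (q : ℂ) ^ 2 = ∑ _s : F, (1 : ℂ) := by simp [card_eq_sq (F := F) hKF]
  calc (q : ℂ) ^ 2 * expSum ψ lam (bordered K c v B)
      = ∑ t : F, ∑ s : F, ∑ x : Fin n → F, ψ (lam (sesq K (bordered K c v B)
          (Fin.cons t (x + s • w)) (Fin.cons t (x + s • w)))) := by
        rw [expSum, sum_fin_succ_fun, hcard, Finset.sum_mul]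
        simp only [one_mul]
        rw [Finset.sum_comm]
        refine Finset.sum_congr rfl fun t _ => Finset.sum_congr rfl fun s _ => ?_
        exact (Fintype.sum_equiv (Equiv.addRight (s • w)) _ (fun x => ψ (lam (sesq K
          (bordered K c v B) (Fin.cons t x) (Fin.cons t x)))) fun x => rfl).symm
    _ = ∑ t : F, ∑ s : F, ∑ x : Fin n → F, ψ (lam (sesq K (bordered K c v B)
          (Fin.cons t x) (Fin.cons t x))) * ψ (Algebra.trace K F (σ t * s)) := by
        simp only [hshift, map_add, hlam, AddChar.map_add_eq_mul]
    _ = (q : ℂ) ^ 2 * expSum ψ lam B := by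
        simp only [← Finset.sum_mul, ← Finset.mul_sum]
        rw [Fintype.sum_eq_single (0 : F)]
        · simp [sesq_bordered, expSum, card_eq_sq (F := F) hKF, mul_comm]
        · intro t ht
          rw [sum_addChar_trace hψ (by simpa using ht), mul_zero]

end NotRangeCase

theorem exists_algebraMap_eq_sesq [Fintype F] (hKF : Module.finrank K F = 2)
    {B : Matrix (Fin n) (Fin n) F} (hB : B ∈ hermitianMatrices K F n) (u : Fin n → F) :
    ∃ a : K, algebraMap K F a = sesq K B u u :=
  exists_algebraMap_eq_of_frobenius_eq (frobenius_sesq hKF hB u u)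

/-- The exponential sum of a Hermitian matrix of rank `r` is `(-1) ^ r * q ^ (2 * n - r)`. -/
theorem expSum_mul [Fintype F] (hKF : Module.finrank K F = 2) {ψ : AddChar K ℂ} (hψ : ψ ≠ 1)
    {lam : F →ₗ[K] K} (hlam : ∀ c, lam (algebraMap K F c) = c)
    (B : hermitianMatrices K F n) :
    expSum ψ lam B.1 * (-(q : ℂ)) ^ B.1.rank = (q : ℂ) ^ (2 * n) := by
  revert B
  induction n with
  | zero =>
    rintro ⟨B, hB⟩
    have h : B.rank = 0 := by simpa using B.rank_le_width
    simp [expSum, sesq, h]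
  | succ n ih =>
    rintro ⟨M, hM⟩
    obtain ⟨c, v, B, hB, rfl⟩ := exists_eq_bordered hM
    simp only
    have h := ih ⟨B, hB⟩
    by_cases hv : ∃ u, B *ᵥ u = v
    · obtain ⟨u, rfl⟩ := hv
      obtain ⟨a, ha⟩ := exists_algebraMap_eq_sesq hKF hB u
      rw [expSum_bordered_mulVec hKF hψ hlam hB ha, rank_bordered_mulVec hKF hB ha]
      split_ifs
      · linear_combination (q : ℂ) ^ 2 * h
      · linear_combination (q : ℂ) ^ 2 * h
    · rw [expSum_bordered_of_notMem_range hKF hψ hlam hB hv,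
        rank_bordered_of_notMem_range hKF hB hv]
      linear_combination (q : ℂ) ^ 2 * h

/-- Summing a function of the rank over all Hermitian matrices of order `n + 1` with a given
corner `B`: among the `q ^ (2 * n) * q` borderings, those with first column outside the range of `B`
raise the rank by two; the others leave it unchanged or raise it by one. -/
theorem sum_rank_succ [Fintype F] (hKF : Module.finrank K F = 2) {R : Type*} [CommRing R]
    (g : ℕ → R) :
    ∑ M : hermitianMatrices K F (n + 1), g M.1.rank =
      ∑ B : hermitianMatrices K F n, ((q : R) ^ (2 * B.1.rank) *
        (g B.1.rank + ((q : R) - 1) * g (B.1.rank + 1)) +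
        ((q : R) ^ (2 * n) - (q : R) ^ (2 * B.1.rank)) * q * g (B.1.rank + 2)) := by
  rw [sum_hermitianMatrices_succ hKF fun M => g M.rank]
  refine Finset.sum_congr rfl fun B _ => ?_
  have h1 : ∀ v : Fin n → F, ∑ c : K, g (bordered K c v B.1).rank =
      if ∃ u, B.1 *ᵥ u = v then g B.1.rank + ((q : R) - 1) * g (B.1.rank + 1)
        else q * g (B.1.rank + 2) := by
    intro v
    split_ifs with hv
    · obtain ⟨u, rfl⟩ := hv
      obtain ⟨a, ha⟩ := exists_algebraMap_eq_sesq hKF B.2 u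
      simp only [rank_bordered_mulVec hKF B.2 ha]
      rw [← Finset.add_sum_erase _ _ (Finset.mem_univ a), if_pos rfl,
        Finset.sum_congr rfl fun c hc => by rw [if_neg (Finset.ne_of_mem_erase hc)],
        Finset.sum_const, Finset.card_erase_of_mem (Finset.mem_univ _), Finset.card_univ,
        nsmul_eq_mul, Nat.cast_sub Fintype.card_pos, add_zero, Nat.cast_one]
    · simp [rank_bordered_of_notMem_range hKF B.2 hv]
  have h2 : ((#{v : Fin n → F | ¬ ∃ u, B.1 *ᵥ u = v} : ℕ) : R) =
      (q : R) ^ (2 * n) - (q : R) ^ (2 * B.1.rank) := by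
    rw [eq_sub_iff_add_eq', pow_mul, pow_mul]
    have h := Finset.card_filter_add_card_filter_not (s := (univ : Finset (Fin n → F)))
      (fun v => ∃ u, B.1 *ᵥ u = v)
    rw [card_range_mulVec hKF, Finset.card_univ, Fintype.card_fun, Fintype.card_fin,
      card_eq_sq (F := F) hKF] at h
    exact_mod_cast congrArg (Nat.cast (R := R)) h
  rw [Finset.sum_congr rfl fun v _ => h1 v, Finset.sum_ite, Finset.sum_const, Finset.sum_const,
    nsmul_eq_mul, nsmul_eq_mul, h2, card_range_mulVec hKF, pow_mul]
  push_cast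
  ring

end RankStep

/-! ### Averages over all Hermitian matrices, and the number of matrices of given rank -/

section QFactorial

/-- The polynomial `(y - 1) (y - b) ⋯ (y - b ^ (j - 1))`. -/
def qProd {R : Type*} [CommRing R] (b y : R) (j : ℕ) : R :=
  ∏ i ∈ range j, (y - b ^ i)

theorem qProd_zero {R : Type*} [CommRing R] (b y : R) : qProd b y 0 = 1 := rfl

theorem qProd_succ {R : Type*} [CommRing R] (b y : R) (j : ℕ) :
    qProd b y (j + 1) = qProd b y j * (y - b ^ j) :=
  Finset.prod_range_succ _ _

theorem qProd_mul_succ {R : Type*} [CommRing R] (b y : R) (j : ℕ) :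
    qProd b (b * y) (j + 1) = b ^ j * (b * y - 1) * qProd b y j := by
  have h : ∀ i ∈ range j, b * y - b ^ (i + 1) = b * (y - b ^ i) := fun i _ => by ring
  rw [qProd, Finset.prod_range_succ', Finset.prod_congr rfl h, Finset.prod_mul_distrib, qProd]
  simp
  ring

/-- The effect on `qProd` of the transition from a matrix of corank `m` to its borderings, where
`y = b ^ m` and `b = -q`. -/
theorem qProd_step {k : Type*} [Field k] {b : k} (hb : b ≠ 0) (y : k) (j : ℕ) :
    b ^ (j + 1) * (qProd b (b * y) (j + 1) + (-b - 1) * qProd b y (j + 1) +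
        (y ^ 2 - 1) * -b * qProd b (y / b) (j + 1)) =
      -b * y ^ 2 * (qProd b y (j + 1) + (1 - b ^ (j + 1)) * qProd b y j) := by
  have h1 := qProd_mul_succ b y j
  have h2 := qProd_mul_succ b (y / b) (j + 1)
  rw [mul_div_cancel₀ _ hb, qProd_succ, qProd_succ] at h2
  rw [h1, qProd_succ b y]
  linear_combination (y + 1) * b * h2

theorem qProd_one_succ {R : Type*} [CommRing R] (b : R) (j : ℕ) : qProd b 1 (j + 1) = 0 :=
  Finset.prod_eq_zero (Finset.mem_range.2 j.succ_pos) (by simp)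

end QFactorial

section Average

variable {K F : Type*} [Field K] [Fintype K] [Field F] [Algebra K F] {n : ℕ}

local notation "q" => Fintype.card K

theorem card_hermitianMatrices [Fintype F] (hKF : Module.finrank K F = 2) :
    Fintype.card (hermitianMatrices K F n) = q ^ (n ^ 2) := by
  have h : ((Fintype.card (hermitianMatrices K F n) : ℕ) : ℂ) = (q : ℂ) ^ (n ^ 2) := by
    induction n with
    | zero =>
      have : Unique (hermitianMatrices K F 0) := Unique.mk' _
      simp
    | succ n ih =>
      have h := sum_rank_succ (F := F) (n := n) hKF fun _ => (1 : ℂ)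
      simp only [Finset.sum_const, Finset.card_univ, nsmul_eq_mul, mul_one] at h
      rw [h]
      have h1 : ∀ B : hermitianMatrices K F n, (q : ℂ) ^ (2 * B.1.rank) * (1 + ((q : ℂ) - 1)) +
          ((q : ℂ) ^ (2 * n) - (q : ℂ) ^ (2 * B.1.rank)) * q = (q : ℂ) ^ (2 * n + 1) :=
        fun B => by ring
      rw [Finset.sum_congr rfl fun B _ => h1 B, Finset.sum_const, Finset.card_univ, nsmul_eq_mul,
        ih]
      ring
  exact_mod_cast h

theorem rank_eq_zero_of_fin_zero (B : Matrix (Fin 0) (Fin 0) F) : B.rank = 0 := by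
  simpa using B.rank_le_width

/-- The sum over all Hermitian matrices of `qProd`, evaluated at `(-q) ^ corank`; the power of `-q`
is written as a quotient, so that no natural subtraction occurs. -/
theorem sum_qProd [Fintype F] (hKF : Module.finrank K F = 2) (j : ℕ) :
    (-(q : ℂ)) ^ (n * j) * ∑ B : hermitianMatrices K F n,
        qProd (-(q : ℂ)) ((-(q : ℂ)) ^ n / (-(q : ℂ)) ^ B.1.rank) j =
      (-1) ^ j * (q : ℂ) ^ (n ^ 2) * qProd (-(q : ℂ)) ((-(q : ℂ)) ^ n) j := by
  induction n generalizing j with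
  | zero =>
    have h1 : Fintype.card (hermitianMatrices K F 0) = 1 := by
      simpa using card_hermitianMatrices (n := 0) (F := F) hKF
    cases j with
    | zero => simp [qProd_zero, h1]
    | succ j => simp [rank_eq_zero_of_fin_zero, qProd_one_succ]
  | succ n ih =>
    cases j with
    | zero => simp [qProd_zero, card_hermitianMatrices hKF]
    | succ j =>
      have hq : (q : ℂ) ≠ 0 := by simp
      have hqb : (q : ℂ) = -(-(q : ℂ)) := (neg_neg _).symm
      have ih1 := ih (j + 1)
      have ih0 := ih j
      rw [sum_rank_succ hKF fun r =>
        qProd (-(q : ℂ)) ((-(q : ℂ)) ^ (n + 1) / (-(q : ℂ)) ^ r) (j + 1)]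
      have hb : -(q : ℂ) ≠ 0 := neg_ne_zero.2 hq
      generalize hbdef : -(q : ℂ) = b at *
      rw [hqb]
      rw [hqb] at ih0 ih1
      -- the share of the borderings of a matrix of rank `r`: `qProd_step` at `y = b ^ n / b ^ r`
      have hstep : ∀ r : ℕ, b ^ (j + 1) * ((-b) ^ (2 * r) * (qProd b (b ^ (n + 1) / b ^ r) (j + 1) +
            (-b - 1) * qProd b (b ^ (n + 1) / b ^ (r + 1)) (j + 1)) +
            ((-b) ^ (2 * n) - (-b) ^ (2 * r)) * (-b) *
              qProd b (b ^ (n + 1) / b ^ (r + 2)) (j + 1)) =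
          -b * b ^ (2 * n) * (qProd b (b ^ n / b ^ r) (j + 1) +
            (1 - b ^ (j + 1)) * qProd b (b ^ n / b ^ r) j) := by
        intro r
        have h := qProd_step hb (b ^ n / b ^ r) j
        have e0 : b ^ (n + 1) / b ^ r = b * (b ^ n / b ^ r) := by ring
        have e1 : b ^ (n + 1) / b ^ (r + 1) = b ^ n / b ^ r := by field_simp; ring
        have e2 : b ^ (n + 1) / b ^ (r + 2) = b ^ n / b ^ r / b := by field_simp; ring
        have e3 : b ^ (2 * n) = b ^ (2 * r) * (b ^ n / b ^ r) ^ 2 := by field_simp; ring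
        have e4 : ∀ m, (-b) ^ (2 * m) = b ^ (2 * m) := fun m => by rw [pow_mul, neg_sq, ← pow_mul]
        rw [e0, e1, e2, e4, e4, e3]
        linear_combination b ^ (2 * r) * h
      have hP := qProd_mul_succ b (b ^ n) j
      have hP' := qProd_succ b (b ^ n) j
      rw [← pow_succ'] at hP
      have e5 : (-b) ^ ((n + 1) ^ 2) = -b * b ^ (2 * n) * (-b) ^ (n ^ 2) := by
        have : b ^ (2 * n) = (-b) ^ (2 * n) := by rw [pow_mul, pow_mul, neg_sq]
        rw [this]; ring
      have e6 : b ^ ((n + 1) * (j + 1)) = b ^ (n * (j + 1)) * b ^ (j + 1) := by ring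
      rw [e5, hP, e6, mul_assoc, Finset.mul_sum, Finset.sum_congr rfl fun B _ => hstep _,
        ← Finset.mul_sum, Finset.sum_add_distrib, ← Finset.mul_sum]
      rw [hP'] at ih1
      have ih0' : b ^ (n * (j + 1)) * (∑ B : hermitianMatrices K F n,
          qProd b (b ^ n / b ^ B.1.rank) j) =
          b ^ n * ((-1) ^ j * (-b) ^ (n ^ 2) * qProd b (b ^ n) j) := by
        rw [← ih0]; ring
      linear_combination -b * b ^ (2 * n) * ih1 + -b * b ^ (2 * n) * (1 - b ^ (j + 1)) * ih0'

end Average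

section Count

variable {K F : Type*} [Field K] [Fintype K] [Field F] [Algebra K F]

local notation "q" => Fintype.card K

variable (K F) in
/-- The number of Hermitian matrices of order `n` and rank `r`. -/
noncomputable def rankCount [Fintype F] (n r : ℕ) : ℝ :=
  ∑ B : hermitianMatrices K F n, if B.1.rank = r then 1 else 0

theorem rankCount_succ [Fintype F] (hKF : Module.finrank K F = 2) (n r : ℕ) :
    rankCount K F (n + 1) r =
      ∑ B : hermitianMatrices K F n, ((q : ℝ) ^ (2 * B.1.rank) *
        ((if B.1.rank = r then 1 else 0) + ((q : ℝ) - 1) * (if B.1.rank + 1 = r then 1 else 0)) +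
        ((q : ℝ) ^ (2 * n) - (q : ℝ) ^ (2 * B.1.rank)) * q *
          (if B.1.rank + 2 = r then 1 else 0)) :=
  sum_rank_succ hKF fun s => if s = r then (1 : ℝ) else 0

theorem rankCount_fin_zero [Fintype F] (r : ℕ) :
    rankCount K F 0 r = if r = 0 then 1 else 0 := by
  have : Unique (hermitianMatrices K F 0) := Unique.mk' _
  simp [rankCount, rank_eq_zero_of_fin_zero, eq_comm]

theorem rankCount_zero [Fintype F] (hKF : Module.finrank K F = 2) (n : ℕ) :
    rankCount K F n 0 = 1 := by
  induction n with
  | zero => simp [rankCount_fin_zero]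
  | succ n ih =>
    rw [rankCount_succ hKF]
    refine Eq.trans ?_ ih
    rw [rankCount]
    refine Finset.sum_congr rfl fun B _ => ?_
    by_cases h : B.1.rank = 0 <;> simp [h]

theorem rankCount_one [Fintype F] (hKF : Module.finrank K F = 2) (n : ℕ) :
    ((q : ℝ) + 1) * rankCount K F n 1 = (q : ℝ) ^ (2 * n) - 1 := by
  induction n with
  | zero => simp [rankCount_fin_zero]
  | succ n ih =>
    have h : rankCount K F (n + 1) 1 =
        (q : ℝ) ^ 2 * rankCount K F n 1 + ((q : ℝ) - 1) * rankCount K F n 0 := by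
      rw [rankCount_succ hKF, rankCount, rankCount,
        Finset.mul_sum, Finset.mul_sum, ← Finset.sum_add_distrib]
      refine Finset.sum_congr rfl fun B _ => ?_
      by_cases h0 : B.1.rank = 0
      · simp [h0]
      · by_cases h1 : B.1.rank = 1 <;> simp [h0, h1]
    rw [h, rankCount_zero hKF]
    linear_combination (q : ℝ) ^ 2 * ih

/-- The factor `q * (q ^ (2 * n - 2) - 1)` of the usual formula is multiplied by `q` here and
written as a difference, so that no truncated exponent occurs for `n = 0`. -/
theorem rankCount_two [Fintype F] (hKF : Module.finrank K F = 2) (n : ℕ) :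
    (q : ℝ) * (((q : ℝ) + 1) * ((q : ℝ) ^ 2 - 1)) * rankCount K F n 2 =
      ((q : ℝ) ^ (2 * n) - 1) * ((q : ℝ) ^ (2 * n) - (q : ℝ) ^ 2) := by
  induction n with
  | zero => simp [rankCount_fin_zero]
  | succ n ih =>
    have h : rankCount K F (n + 1) 2 =
        (q : ℝ) ^ 4 * rankCount K F n 2 + (q : ℝ) ^ 2 * ((q : ℝ) - 1) * rankCount K F n 1 +
          ((q : ℝ) ^ (2 * n) - 1) * q * rankCount K F n 0 := by
      rw [rankCount_succ hKF, rankCount, rankCount,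
        rankCount, Finset.mul_sum, Finset.mul_sum, Finset.mul_sum, ← Finset.sum_add_distrib,
        ← Finset.sum_add_distrib]
      refine Finset.sum_congr rfl fun B _ => ?_
      by_cases h0 : B.1.rank = 0
      · simp [h0]
      · by_cases h1 : B.1.rank = 1
        · simp [h1]
        · by_cases h2 : B.1.rank = 2 <;> simp [h0, h1, h2]
    have h1 := rankCount_one (F := F) hKF n
    rw [h, rankCount_zero hKF]
    linear_combination (q : ℝ) ^ 4 * ih + (q : ℝ) ^ 3 * ((q : ℝ) - 1) * ((q : ℝ) ^ 2 - 1) * h1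

end Count

/-! ### The dual code and the Singleton-like bound -/

section Duality

theorem addChar_map_sum {A ι : Type*} [AddCommMonoid A] (ψ : AddChar A ℂ) (s : Finset ι)
    (f : ι → A) : ψ (∑ i ∈ s, f i) = ∏ i ∈ s, ψ (f i) := by
  induction s using Finset.induction_on with
  | empty => simp
  | insert i s hi ih => rw [Finset.sum_insert hi, Finset.prod_insert hi, ψ.map_add_eq_mul, ih]

theorem sum_submodule_eq_sum {k V : Type*} [Field k] [AddCommGroup V] [Module k V] [Fintype V]
    {D : Submodule k V} (hD : ∀ v, v ∈ D) (f : V → ℂ) : ∑ v : D, f v = ∑ v, f v :=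
  Fintype.sum_bijective Subtype.val
    ⟨Subtype.val_injective, fun v => ⟨⟨v, hD v⟩, rfl⟩⟩ _ _ fun _ => rfl

variable {K F : Type*} [Field K] [Fintype K] [Field F] [Algebra K F] {n : ℕ}

local notation "σ" => FiniteField.frobeniusAlgHom K F
local notation "q" => Fintype.card K

variable (n) in
/-- The bilinear form `(A, B) ↦ lam (tr (A B))` on the space of Hermitian matrices. -/
def traceBilin (lam : F →ₗ[K] K) : LinearMap.BilinForm K (hermitianMatrices K F n) :=
  LinearMap.mk₂ K (fun A B => lam (trace (A.1 * B.1)))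
    (fun A A' B => by simp [add_mul])
    (fun c A B => by simp)
    (fun A B B' => by simp [mul_add])
    (fun c A B => by simp)

theorem traceBilin_apply (lam : F →ₗ[K] K) (A B : hermitianMatrices K F n) :
    traceBilin n lam A B = lam (trace (A.1 * B.1)) := rfl

theorem traceBilin_isSymm (lam : F →ₗ[K] K) : (traceBilin n lam).IsSymm :=
  ⟨fun A B => congrArg lam (trace_mul_comm A.1 B.1)⟩

theorem traceBilin_nondegenerate [Fintype F] (hKF : Module.finrank K F = 2) {lam : F →ₗ[K] K}
    (hlam : ∀ c, lam (algebraMap K F c) = c) : (traceBilin n lam).Nondegenerate := by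
  refine (traceBilin_isSymm lam).isRefl.nondegenerate_iff_separatingLeft.2 fun A hA => ?_
  ext i j
  by_contra hij
  replace hij : A.1 i j ≠ 0 := hij
  obtain ⟨z, hz⟩ := Algebra.trace_surjective K F 1
  -- test against the Hermitian matrix with the entries `t` and `σ t` at `(j, i)` and `(i, j)`
  let t : F := z / A.1 i j
  have hmem : Matrix.single j i t + Matrix.single i j (σ t) ∈ hermitianMatrices K F n := by
    rw [mem_hermitianMatrices]
    intro a b
    have h1 : ∀ (p : Prop) [Decidable p] (x : F), σ (if p then x else 0) = if p then σ x else 0 :=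
      fun p _ x => by split_ifs <;> simp only [map_zero]
    simp only [Matrix.add_apply, Matrix.single_apply, map_add, h1, frobenius_frobenius hKF]
    rw [add_comm]
    simp only [and_comm]
  have h := hA ⟨_, hmem⟩
  rw [traceBilin_apply] at h
  simp only [mul_add, trace_add, Matrix.trace_mul_single, op_smul_eq_smul, smul_eq_mul] at h
  rw [← apply_eq_of_mem A.2 j i, ← map_mul, div_mul_cancel₀ _ hij,
    ← algebraMap_trace_eq_add_frobenius hKF, hlam, hz] at h
  exact one_ne_zero h

/-- The Hermitian matrix `∑ x_i x_i*` of a family of vectors `x_i`. -/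
def outerSum [Fintype F] (hKF : Module.finrank K F = 2) {k : ℕ} (X : Fin k → Fin n → F) :
    hermitianMatrices K F n :=
  ⟨(Matrix.of X)ᵀ * Matrix.of fun i a => σ (X i a), mem_hermitianMatrices.2 fun a b => by
    simp only [Matrix.mul_apply, Matrix.transpose_apply, Matrix.of_apply, map_sum, map_mul,
      frobenius_frobenius hKF, mul_comm]⟩

theorem rank_outerSum_le [Fintype F] (hKF : Module.finrank K F = 2) {k : ℕ}
    (X : Fin k → Fin n → F) : (outerSum hKF X).1.rank ≤ k :=
  (rank_mul_le_left _ _).trans (by simpa using rank_le_width (Matrix.of X)ᵀ)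

theorem traceBilin_outerSum [Fintype F] (hKF : Module.finrank K F = 2) (lam : F →ₗ[K] K) {k : ℕ}
    (X : Fin k → Fin n → F) (B : hermitianMatrices K F n) :
    traceBilin n lam (outerSum hKF X) B = ∑ i, lam (sesq K B.1 (X i) (X i)) := by
  rw [traceBilin_apply, ← map_sum]
  congr 1
  simp only [outerSum, Matrix.mul_assoc, trace_mul_comm (Matrix.of X)ᵀ]
  simp only [trace, diag_apply, Matrix.mul_apply, Matrix.transpose_apply, Matrix.of_apply, sesq,
    dotProduct, mulVec, Finset.mul_sum]

/-- Orthogonality of characters for a code and its dual. -/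
theorem sum_orthogonal_addChar [Fintype F] (hKF : Module.finrank K F = 2) {ψ : AddChar K ℂ}
    (hψ : ψ ≠ 1) {lam : F →ₗ[K] K} (hlam : ∀ c, lam (algebraMap K F c) = c)
    (C : Submodule K (hermitianMatrices K F n)) (G : hermitianMatrices K F n) :
    ∑ B : (traceBilin n lam).orthogonal C, ψ (traceBilin n lam G B.1) =
      if G ∈ C then (Fintype.card ((traceBilin n lam).orthogonal C) : ℂ) else 0 := by
  set β := traceBilin n lam
  split_ifs with hG
  · have h : ∀ B : β.orthogonal C, β G B.1 = 0 := fun B => B.2 G hG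
    simp [h]
  · let χ : AddChar (β.orthogonal C) ℂ :=
      ψ.compAddMonoidHom ((β G).comp (β.orthogonal C).subtype).toAddMonoidHom
    have hχ : χ ≠ 1 := by
      rw [← LinearMap.BilinForm.orthogonal_orthogonal (traceBilin_nondegenerate hKF hlam)
        (traceBilin_isSymm lam).isRefl C, LinearMap.BilinForm.mem_orthogonal_iff] at hG
      push Not at hG
      obtain ⟨B, hB, hBG⟩ := hG
      have hGB : β G B ≠ 0 := fun h => hBG (((traceBilin_isSymm lam).eq G B).symm.trans h)
      obtain ⟨c, hc⟩ := AddChar.ne_one_iff.1 hψ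
      refine AddChar.ne_one_iff.2 ⟨(c / β G B) • ⟨B, hB⟩, ?_⟩
      simpa [χ, hGB] using hc
    exact AddChar.sum_eq_zero_of_ne_one hχ

/-- The `k`-th power of an exponential sum is a sum over families of `k` vectors. Hence the `k`-th
moment over the dual code counts the families whose matrix lies in the code. -/
theorem sum_orthogonal_expSum_pow [Fintype F] (hKF : Module.finrank K F = 2) {ψ : AddChar K ℂ}
    (hψ : ψ ≠ 1) {lam : F →ₗ[K] K} (hlam : ∀ c, lam (algebraMap K F c) = c)
    (C : Submodule K (hermitianMatrices K F n)) (k : ℕ) :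
    ∑ B : (traceBilin n lam).orthogonal C, expSum ψ lam B.1.1 ^ k =
      Fintype.card ((traceBilin n lam).orthogonal C) *
        (#{X : Fin k → Fin n → F | outerSum hKF X ∈ C} : ℂ) := by
  have h : ∀ B : (traceBilin n lam).orthogonal C, expSum ψ lam B.1.1 ^ k =
      ∑ X : Fin k → Fin n → F, ψ (traceBilin n lam (outerSum hKF X) B.1) := by
    intro B
    rw [expSum, Finset.sum_pow', Fintype.piFinset_univ]
    refine Finset.sum_congr rfl fun X _ => ?_
    rw [traceBilin_outerSum, addChar_map_sum]
  rw [Finset.sum_congr rfl fun B _ => h B, Finset.sum_comm,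
    Finset.sum_congr rfl fun X _ => sum_orthogonal_addChar hKF hψ hlam C _, ← Finset.sum_filter,
    Finset.sum_const, nsmul_eq_mul, mul_comm]

theorem card_mul_card_orthogonal [Fintype F] (hKF : Module.finrank K F = 2) {lam : F →ₗ[K] K}
    (hlam : ∀ c, lam (algebraMap K F c) = c) (C : Submodule K (hermitianMatrices K F n)) :
    Fintype.card C * Fintype.card ((traceBilin n lam).orthogonal C) = q ^ (n ^ 2) := by
  rw [Module.card_eq_pow_finrank (K := K) (V := C),
    Module.card_eq_pow_finrank (K := K) (V := (traceBilin n lam).orthogonal C), ← pow_add,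
    LinearMap.BilinForm.finrank_orthogonal (traceBilin_nondegenerate hKF hlam),
    Nat.add_sub_cancel' C.finrank_le, ← Module.card_eq_pow_finrank, card_hermitianMatrices hKF]

/-- If a code has no nonzero matrix of rank at most `j`, then the moments of order at most `j` of
its dual agree with those of the space of all Hermitian matrices. -/
theorem sum_orthogonal_eval [Fintype F] (hKF : Module.finrank K F = 2) {ψ : AddChar K ℂ}
    (hψ : ψ ≠ 1) {lam : F →ₗ[K] K} (hlam : ∀ c, lam (algebraMap K F c) = c)
    {C : Submodule K (hermitianMatrices K F n)} {j : ℕ}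
    (hC : ∀ A ∈ C, A.1.rank ≤ j → A = 0) {p : Polynomial ℂ} (hp : p.natDegree ≤ j) :
    (q : ℂ) ^ (n ^ 2) * ∑ B : (traceBilin n lam).orthogonal C, p.eval (expSum ψ lam B.1.1) =
      Fintype.card ((traceBilin n lam).orthogonal C) *
        ∑ B : hermitianMatrices K F n, p.eval (expSum ψ lam B.1) := by
  have hmom : ∀ k ≤ j,
      (q : ℂ) ^ (n ^ 2) * ∑ B : (traceBilin n lam).orthogonal C, expSum ψ lam B.1.1 ^ k =
      Fintype.card ((traceBilin n lam).orthogonal C) *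
        ∑ B : hermitianMatrices K F n, expSum ψ lam B.1 ^ k := by
    intro k hk
    -- the zero code has all Hermitian matrices in its dual
    have h0 : ∑ B : hermitianMatrices K F n, expSum ψ lam B.1 ^ k =
        (q : ℂ) ^ (n ^ 2) * #{X : Fin k → Fin n → F | outerSum hKF X = 0} := by
      have h := sum_orthogonal_expSum_pow (n := n) hKF hψ hlam ⊥ k
      have hcard := card_mul_card_orthogonal (n := n) hKF hlam ⊥
      rw [show Fintype.card (⊥ : Submodule K (hermitianMatrices K F n)) = 1 by simp,
        one_mul] at hcard
      rw [hcard] at h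
      simp only [Submodule.mem_bot] at h
      have hD : ∀ B, B ∈ (traceBilin n lam).orthogonal ⊥ := fun B => by
        rw [LinearMap.BilinForm.orthogonal_bot]
        exact Submodule.mem_top
      have hsum := sum_submodule_eq_sum hD fun B => expSum ψ lam B.1 ^ k
      rw [← Nat.cast_pow, ← h, ← hsum]
    rw [sum_orthogonal_expSum_pow hKF hψ hlam, h0]
    have hset : ∀ X : Fin k → Fin n → F, outerSum hKF X ∈ C ↔ outerSum hKF X = 0 := fun X =>
      ⟨fun hX => hC _ hX ((rank_outerSum_le hKF X).trans hk), fun hX => hX ▸ C.zero_mem⟩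
    simp only [hset]
    ring
  simp only [Polynomial.eval_eq_sum_range' (Nat.lt_succ_of_le hp)]
  rw [Finset.sum_comm, Finset.mul_sum, Finset.sum_comm, Finset.mul_sum]
  refine Finset.sum_congr rfl fun k hk => ?_
  rw [← Finset.mul_sum, ← Finset.mul_sum, mul_left_comm, hmom k (Finset.mem_range_succ_iff.1 hk),
    mul_left_comm]

/-- The identity on which the bound rests: all the terms of the sum are divisible by the
constant `∏ (-q) ^ i`, `i < j`, while the right-hand side is that constant times the size of the
dual code times a number prime to `q`. -/
theorem sum_orthogonal_qProd [Fintype F] (hKF : Module.finrank K F = 2) {ψ : AddChar K ℂ}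
    (hψ : ψ ≠ 1) {lam : F →ₗ[K] K} (hlam : ∀ c, lam (algebraMap K F c) = c)
    {C : Submodule K (hermitianMatrices K F n)} {j : ℕ}
    (hC : ∀ A ∈ C, A.1.rank ≤ j → A = 0) :
    (-(q : ℤ)) ^ (n * j) * ∑ B : (traceBilin n lam).orthogonal C,
        qProd (-(q : ℤ)) ((-(q : ℤ)) ^ (n - B.1.1.rank)) j =
      (-1) ^ j * Fintype.card ((traceBilin n lam).orthogonal C) *
        qProd (-(q : ℤ)) ((-(q : ℤ)) ^ n) j := by
  have hq : (q : ℂ) ≠ 0 := by simp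
  have hb : -(q : ℂ) ≠ 0 := neg_ne_zero.2 hq
  -- `p` is the polynomial of `qProd` in the variable `expSum / (-q) ^ n`
  let p : Polynomial ℂ := ∏ i ∈ range j,
    (Polynomial.C ((-(q : ℂ)) ^ n)⁻¹ * Polynomial.X - Polynomial.C ((-(q : ℂ)) ^ i))
  have hp : p.natDegree ≤ j := by
    refine (Polynomial.natDegree_prod_le _ _).trans ?_
    refine (Finset.sum_le_card_nsmul _ _ 1 fun i _ => ?_).trans (by simp)
    exact (Polynomial.natDegree_sub_C).trans_le ((Polynomial.natDegree_C_mul_le _ _).trans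
      Polynomial.natDegree_X_le)
  have heval : ∀ B : hermitianMatrices K F n, p.eval (expSum ψ lam B.1) =
      qProd (-(q : ℂ)) ((-(q : ℂ)) ^ n / (-(q : ℂ)) ^ B.1.rank) j := by
    intro B
    have h := expSum_mul hKF hψ hlam B
    have hy : ((-(q : ℂ)) ^ n)⁻¹ * expSum ψ lam B.1 = (-(q : ℂ)) ^ n / (-(q : ℂ)) ^ B.1.rank := by
      rw [eq_div_iff (pow_ne_zero _ hb), mul_assoc, h, inv_mul_eq_iff_eq_mul₀ (pow_ne_zero _ hb),
        ← pow_add, ← two_mul, pow_mul, pow_mul, neg_sq]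
    simp only [p, Polynomial.eval_prod, Polynomial.eval_sub, Polynomial.eval_mul,
      Polynomial.eval_C, Polynomial.eval_X, hy, qProd]
  have h1 := sum_orthogonal_eval hKF hψ hlam hC hp
  have h2 := sum_qProd (F := F) (n := n) hKF j
  simp only [heval] at h1
  have h3 : (-(q : ℂ)) ^ (n * j) * ∑ B : (traceBilin n lam).orthogonal C,
        qProd (-(q : ℂ)) ((-(q : ℂ)) ^ n / (-(q : ℂ)) ^ B.1.1.rank) j =
      (-1) ^ j * Fintype.card ((traceBilin n lam).orthogonal C) *
        qProd (-(q : ℂ)) ((-(q : ℂ)) ^ n) j := by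
    apply mul_left_cancel₀ (pow_ne_zero (n ^ 2) hq)
    linear_combination (-(q : ℂ)) ^ (n * j) * h1 +
      (Fintype.card ((traceBilin n lam).orthogonal C) : ℂ) * h2
  have h4 : ∀ B : (traceBilin n lam).orthogonal C,
      (-(q : ℂ)) ^ n / (-(q : ℂ)) ^ B.1.1.rank = (-(q : ℂ)) ^ (n - B.1.1.rank) := fun B =>
    (pow_sub₀ _ hb (by simpa using B.1.1.rank_le_width)).symm
  simp only [h4, qProd] at h3
  simp only [qProd]
  exact_mod_cast h3

theorem prod_pow_dvd_qProd {R : Type*} [CommRing R] (b : R) (m j : ℕ) :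
    ∏ i ∈ range j, b ^ i ∣ qProd b (b ^ m) j := by
  by_cases h : m < j
  · have h0 : qProd b (b ^ m) j = 0 := Finset.prod_eq_zero (Finset.mem_range.2 h) (sub_self _)
    exact h0 ▸ dvd_zero _
  · exact Finset.prod_dvd_prod_of_dvd _ _ fun i hi =>
      dvd_sub (pow_dvd_pow b (by have := Finset.mem_range.1 hi; omega)) dvd_rfl

theorem exists_qProd_eq_mul_isCoprime {R : Type*} [CommRing R] (b : R) {m j : ℕ} (h : j ≤ m) :
    ∃ u : R, qProd b (b ^ m) j = (∏ i ∈ range j, b ^ i) * u ∧ IsCoprime b u := by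
  refine ⟨∏ i ∈ range j, (b ^ (m - i) - 1), ?_, IsCoprime.prod_right fun i hi => ?_⟩
  · rw [qProd, ← Finset.prod_mul_distrib]
    refine Finset.prod_congr rfl fun i hi => ?_
    have := Finset.mem_range.1 hi
    rw [mul_sub, ← pow_add, Nat.add_sub_cancel' (by omega), mul_one]
  · have := Finset.mem_range.1 hi
    refine ⟨b ^ (m - i - 1), -1, ?_⟩
    rw [← pow_succ, Nat.sub_add_cancel (by omega)]
    ring

/-- The Singleton-like bound for linear Hermitian codes. -/
theorem card_mul_pow_le [Fintype F] (hKF : Module.finrank K F = 2)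
    {C : Submodule K (hermitianMatrices K F n)} {j : ℕ} (hj : j ≤ n)
    (hC : ∀ A ∈ C, A.1.rank ≤ j → A = 0) :
    Fintype.card C * q ^ (n * j) ≤ q ^ (n ^ 2) := by
  obtain ⟨ψ, hψ⟩ : ∃ ψ : AddChar K ℂ, ψ ≠ 1 := by
    obtain ⟨ψ, hψ⟩ := AddChar.exists_apply_ne_zero.2 (one_ne_zero (α := K))
    exact ⟨ψ, AddChar.ne_one_iff.2 ⟨1, hψ⟩⟩
  obtain ⟨lam, hlam'⟩ := LinearMap.exists_leftInverse_of_injective (Algebra.linearMap K F)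
    (LinearMap.ker_eq_bot.2 (algebraMap K F).injective)
  have hlam : ∀ c, lam (algebraMap K F c) = c := fun c => LinearMap.congr_fun hlam' c
  have h := sum_orthogonal_qProd hKF hψ hlam hC
  rw [← card_mul_card_orthogonal hKF hlam C]
  refine Nat.mul_le_mul_left _ (Nat.le_of_dvd Fintype.card_pos ?_)
  obtain ⟨u, hu, hcop⟩ := exists_qProd_eq_mul_isCoprime (-(q : ℤ)) hj
  obtain ⟨s, hs⟩ := Finset.dvd_sum (s := univ) fun (B : (traceBilin n lam).orthogonal C) _ =>
    prod_pow_dvd_qProd (-(q : ℤ)) (n - B.1.1.rank) j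
  have hD : ∏ i ∈ range j, (-(q : ℤ)) ^ i ≠ 0 :=
    Finset.prod_ne_zero_iff.2 fun i _ => pow_ne_zero _ (by simp)
  rw [hs, hu] at h
  have h' : (-(q : ℤ)) ^ (n * j) * s =
      Fintype.card ((traceBilin n lam).orthogonal C) * ((-1) ^ j * u) := by
    apply mul_left_cancel₀ hD
    linear_combination h
  have hdvd : (-(q : ℤ)) ^ (n * j) ∣ Fintype.card ((traceBilin n lam).orthogonal C) := by
    refine IsCoprime.dvd_of_dvd_mul_right (z := (-1) ^ j * u) ?_ ⟨s, h'.symm⟩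
    refine IsCoprime.pow_left (IsCoprime.mul_right ?_ hcop)
    exact (isCoprime_one_right.neg_right).pow_right
  rw [neg_pow, (isUnit_one.neg.pow _).mul_left_dvd] at hdvd
  exact_mod_cast hdvd

end Duality

/-! ### The packing density -/

section Density

theorem minDist_le_rank {K F : Type*} [Field K] [Field F] [Algebra K F] {n : ℕ}
    {C : Submodule K (Matrix (Fin n) (Fin n) F)} {A : Matrix (Fin n) (Fin n) F}
    (hA : A ∈ C) (h0 : A ≠ 0) : minDist C ≤ A.rank :=
  Nat.sInf_le ⟨A, hA, 0, C.zero_mem, h0, by rw [rankDist, sub_zero]⟩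

/-- For the zero code the minimum distance is `0` by convention, so the bound holds there too. -/
theorem minDist_le {K F : Type*} [Field K] [Field F] [Algebra K F] {n : ℕ}
    (C : Submodule K (Matrix (Fin n) (Fin n) F)) : minDist C ≤ n := by
  by_cases h : {r | ∃ A ∈ C, ∃ B ∈ C, A ≠ B ∧ rankDist A B = r}.Nonempty
  · obtain ⟨A, -, B, -, -, hr⟩ := Nat.sInf_mem h
    rw [minDist, ← hr]
    simpa [rankDist] using (A - B).rank_le_width
  · rw [minDist, Set.not_nonempty_iff_eq_empty.1 h, Nat.sInf_empty]
    exact Nat.zero_le n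

variable {K F : Type*} [Field K] [Fintype K] [Field F] [Algebra K F] {n : ℕ}

local notation "q" => Fintype.card K

theorem ballSize_eq_sum_rankCount [Fintype F] (r : ℕ) :
    (ballSize K F n r : ℝ) = ∑ s ∈ range (r + 1), rankCount K F n s := by
  have h1 : ball K (0 : Matrix (Fin n) (Fin n) F) r =
      Subtype.val '' {B : hermitianMatrices K F n | B.1.rank ≤ r} := by
    ext N
    have hN : (0 - N).rank = N.rank := by
      have h : (-N).mulVecLin = -N.mulVecLin := by
        ext
        simp
      rw [zero_sub, Matrix.rank, h, LinearMap.range_neg, Matrix.rank]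
    simp only [ball, rankDist, hN, Set.mem_ofPred_eq, Set.mem_image,
      Subtype.exists, exists_and_left, exists_prop, exists_eq_right_right]
    exact and_comm
  rw [ballSize, h1, Set.ncard_image_of_injective _ Subtype.val_injective,
    Set.ncard_eq_toFinset_card', Set.toFinset_ofPred]
  simp only [rankCount]
  rw [Finset.sum_comm, Finset.card_filter]
  push_cast
  refine Finset.sum_congr rfl fun B _ => ?_
  simp

/-- The Singleton-like bound in terms of the density: here `d = j + 1`, so that `t = j / 2`. -/
theorem packingDensity_le [Fintype F] (hKF : Module.finrank K F = 2)
    {C : Submodule K (Matrix (Fin n) (Fin n) F)} (hC : C ≤ hermitianMatrices K F n) {j : ℕ}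
    (hd : minDist C = j + 1) :
    packingDensity C ≤ (∑ s ∈ range (j / 2 + 1), rankCount K F n s) / ((q : ℝ) ^ n) ^ j := by
  have hq : (0 : ℝ) < q := by exact_mod_cast Fintype.card_pos
  have hjn : j ≤ n := by have := minDist_le C; omega
  have hbound : Nat.card C * q ^ (n * j) ≤ q ^ (n ^ 2) := by
    rw [← Nat.card_congr (Submodule.comapSubtypeEquivOfLe hC).toEquiv, Nat.card_eq_fintype_card]
    refine card_mul_pow_le hKF hjn fun A hA hr => ?_
    by_contra h0
    have h : minDist C ≤ A.1.rank := minDist_le_rank hA fun h => h0 (Subtype.ext h)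
    omega
  have hbound' : (Nat.card C : ℝ) * (q : ℝ) ^ (n * j) ≤ (q : ℝ) ^ (n ^ 2) := by
    exact_mod_cast hbound
  rw [packingDensity, hd, Nat.add_sub_cancel, ballSize_eq_sum_rankCount, ← pow_mul,
    div_le_div_iff₀ (by positivity) (by positivity), mul_right_comm, mul_comm (Finset.sum _ _)]
  refine mul_le_mul_of_nonneg_right hbound' (Finset.sum_nonneg fun s _ => ?_)
  exact Finset.sum_nonneg fun B _ => by split_ifs <;> norm_num

end Density

end HermitianCode

theorem mainTheorem6 {K F : Type*} [Field K] [Fintype K] [Field F] [Algebra K F]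
    (hKF : Module.finrank K F = 2) (q n : ℕ) (hq : Fintype.card K = q)
    (C : Submodule K (Matrix (Fin n) (Fin n) F))
    (hC : C ≤ HermitianCode.hermitianMatrices K F n) :
    (HermitianCode.minDist C = 2 →
      HermitianCode.packingDensity C ≤ 1 / (q : ℝ) ^ n) ∧
    (HermitianCode.minDist C = 3 →
      HermitianCode.packingDensity C ≤
        ((q : ℝ) ^ (-2 * (n : ℤ) + 1) + 1) / ((q : ℝ) + 1)) ∧
    (HermitianCode.minDist C = 4 →
      HermitianCode.packingDensity C ≤
        ((q : ℝ) ^ (-3 * (n : ℤ) + 1) + (q : ℝ) ^ (-(n : ℤ))) / ((q : ℝ) + 1)) ∧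
    (HermitianCode.minDist C = 5 →
      HermitianCode.packingDensity C ≤
        (q : ℝ) ^ (-4 * (n : ℤ)) *
          (1 + ((q : ℝ) ^ (2 * (n : ℤ)) - 1) / ((q : ℝ) + 1) +
            (q : ℝ) * ((q : ℝ) ^ (2 * (n : ℤ)) - 1) * ((q : ℝ) ^ (2 * (n : ℤ) - 2) - 1) /
              (((q : ℝ) + 1) * ((q : ℝ) ^ 2 - 1)))) ∧
    (HermitianCode.minDist C = 6 →
      HermitianCode.packingDensity C ≤
        (q : ℝ) ^ (-5 * (n : ℤ)) *
          (1 + ((q : ℝ) ^ (2 * (n : ℤ)) - 1) / ((q : ℝ) + 1) +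
            (q : ℝ) * ((q : ℝ) ^ (2 * (n : ℤ)) - 1) * ((q : ℝ) ^ (2 * (n : ℤ) - 2) - 1) /
              (((q : ℝ) + 1) * ((q : ℝ) ^ 2 - 1)))) := by
  have : Module.Finite K F := Module.finite_of_finrank_eq_succ hKF
  have : Finite F := Module.finite_of_finite K
  have : Fintype F := Fintype.ofFinite F
  have hq1 : (1 : ℝ) < q := by
    rw [← hq]
    exact_mod_cast Fintype.one_lt_card (α := K)
  have hq0 : (q : ℝ) ≠ 0 := by positivity
  have hq2 : (q : ℝ) + 1 ≠ 0 := by positivity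
  have hq3 : (q : ℝ) ^ 2 - 1 ≠ 0 := by nlinarith
  have hQ : (q : ℝ) ^ n ≠ 0 := pow_ne_zero n hq0
  have h0 := HermitianCode.rankCount_zero (F := F) hKF n
  have h1 := HermitianCode.rankCount_one (F := F) hKF n
  have h2 := HermitianCode.rankCount_two (F := F) hKF n
  have hle := fun j => HermitianCode.packingDensity_le (j := j) hKF hC
  rw [hq] at h1 h2 hle
  rw [mul_comm, ← eq_div_iff hq2] at h1
  have h2' : HermitianCode.rankCount K F n 2 = (q : ℝ) * ((q : ℝ) ^ (2 * (n : ℤ)) - 1) *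
      ((q : ℝ) ^ (2 * (n : ℤ) - 2) - 1) / (((q : ℝ) + 1) * ((q : ℝ) ^ 2 - 1)) := by
    rw [eq_div_iff (mul_ne_zero hq2 hq3), zpow_sub₀ hq0]
    norm_cast
    push_cast
    field_simp
    linear_combination h2
  have hz : ∀ k : ℤ, (q : ℝ) ^ (k * (n : ℤ)) = ((q : ℝ) ^ n) ^ k := fun k => by
    rw [mul_comm, zpow_mul, zpow_natCast]
  have hball1 : ∑ s ∈ Finset.range 2, HermitianCode.rankCount K F n s =
      1 + (((q : ℝ) ^ n) ^ 2 - 1) / ((q : ℝ) + 1) := by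
    simp only [Finset.sum_range_succ, Finset.sum_range_zero, zero_add, h0, h1, pow_mul']
  have hball2 : ∑ s ∈ Finset.range 3, HermitianCode.rankCount K F n s =
      1 + ((q : ℝ) ^ (2 * (n : ℤ)) - 1) / ((q : ℝ) + 1) +
            (q : ℝ) * ((q : ℝ) ^ (2 * (n : ℤ)) - 1) * ((q : ℝ) ^ (2 * (n : ℤ) - 2) - 1) /
              (((q : ℝ) + 1) * ((q : ℝ) ^ 2 - 1)) := by
    simp only [Finset.sum_range_succ, Finset.sum_range_zero, zero_add, h0, h1, h2']
    norm_cast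
  refine ⟨fun hd => ?_, fun hd => ?_, fun hd => ?_, fun hd => ?_, fun hd => ?_⟩
  · refine (hle 1 hd).trans_eq ?_
    simp [h0]
  · refine (hle 2 hd).trans_eq ?_
    rw [zpow_add₀ hq0, hz (-2), zpow_neg, zpow_one, zpow_ofNat]
    simp only [hball1]
    field_simp
    ring
  · refine (hle 3 hd).trans_eq ?_
    rw [zpow_add₀ hq0, hz (-3), zpow_neg, zpow_neg, zpow_one, zpow_ofNat, zpow_natCast]
    simp only [hball1]
    field_simp
    ring
  · refine (hle 4 hd).trans_eq ?_
    rw [hball2, hz (-4), zpow_neg, inv_mul_eq_div]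
    norm_cast
  · refine (hle 5 hd).trans_eq ?_
    rw [hball2, hz (-5), zpow_neg, inv_mul_eq_div]
    norm_cast
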